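/- Let $\tau:E\to M$ and $\tau':E'\to M'$ be Lie algebroids, i.e. smooth real vector bundles of finite rank over finite-dimensional smooth manifolds (Hausdorff, $\sigma$-compact, without boundary), each with an anchor (for $E$, a smooth vector bundle map $\rho:E\to TM$ over the identity) and a Lie algebra structure on the smooth sections satisfying $[\sigma,f\eta]=(\rho(\sigma)f)\,\eta+f[\sigma,\eta]$. The exterior differential on $E$ is $$d\omega(\sigma_0,\dots,\sigma_k)=\sum_i(-1)^i\rho(\sigma_i)\bigl(\omega(\sigma_0,\dots,\widehat{\sigma_i},\dots,\sigma_k)\bigr)+\sum_{i<j}(-1)^{i+j}\omega([\sigma_i,\sigma_j],\sigma_0,\dots,\widehat{\sigma_i},\dots,\widehat{\sigma_j},\dots,\sigma_k),$$ and similarly on $E'$. A smooth vector bundle map $\Phi:E\to E'$ over a smooth map $\varphi:M\to M'$ is a morphism of Lie algebroids if $\Phi^\star d\theta=d\Phi^\star\theta$ for every $p\ge 0$ and every $p$-form $\theta$ on $E'$ (a smooth section of $\wedge^pE'^*$). An $E$-path on $[t_0,t_1]$ ($t_0<t_1$) is a $C^1$ curve $a:[t_0,t_1]\to E$ such that $\dot\gamma(t)=\rho(a(t))$,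 where $\gamma=\tau\circ a$. For a smooth function $L:E\to\mathbb R$, a curve $a$ is a solution of Lagrange's equations for $L$ if it is an $E$-path and if, in the coordinates $(x^i,y^\alpha)$ on $E$ determined by any local coordinates $(x^i)$ on $M$ and any local basis $\{e_\alpha\}$ of sections of $E$, with $\rho(e_\alpha)=\rho^i_\alpha\,\partial/\partial x^i$ and $[e_\alpha,e_\beta]=C^\gamma_{\alpha\beta}e_\gamma$, it satisfies $$\frac{d}{dt}\Bigl(\frac{\partial L}{\partial y^\alpha}\Bigr)+\frac{\partial L}{\partial y^\gamma}C^\gamma_{\alpha\beta}\,y^\beta-\rho^i_\alpha\frac{\partial L}{\partial x^i}=0 .$$ Solutions of Lagrange's equations on $E'$ are defined in the same way. **Theorem.** Let $\Phi:E\to E'$ be a morphism of Lie algebroids over $\varphi:M\to M'$ which is fiberwise surjective, i.e. $\Phi_m:E_m\to E'_{\varphi(m)}$ is surjective for every $m\in M$. Let $L\in C^\infty(E)$ and $L'\in C^\infty(E')$ be such that $L=L'\circ\Phi$. If $a:[t_0,t_1]\to E$ is a solution of Lagrange's equations for $L$, then $a'=\Phi\circ a$ is a solution of Lagrange's equations for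 $L'$. -/

import Mathlib

open scoped Manifold ContDiff
open Bundle

section LieAlgebroids

variable (EM : Type*) [NormedAddCommGroup EM] [NormedSpace ℝ EM]
  {M : Type*} [TopologicalSpace M] [ChartedSpace EM M]
  (F : Type*) [NormedAddCommGroup F] [NormedSpace ℝ F]
  (E : M → Type*) [TopologicalSpace (TotalSpace F E)]
  [∀ x, AddCommGroup (E x)] [∀ x, Module ℝ (E x)] [∀ x, TopologicalSpace (E x)]
  [FiberBundle F E] [VectorBundle ℝ F E] [IsManifold 𝓘(ℝ, EM) ∞ M]

/-- The space of smooth global sections of the vector bundle `E → M`. -/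
abbrev SmoothSection := ContMDiffSection 𝓘(ℝ, EM) F ∞ E

variable {EM F E} in
/-- The product `f η` of a smooth function and a smooth section. -/
noncomputable def SmoothSection.funSMul (f : M → ℝ) (hf : ContMDiff 𝓘(ℝ, EM) 𝓘(ℝ, ℝ) ∞ f)
    (η : SmoothSection EM F E) : SmoothSection EM F E :=
  ⟨fun x => f x • η x, hf.smul_section η.contMDiff⟩

variable {EM} in
/-- The derivative `v f` of a real function `f` along a tangent vector `v` at `x`. -/
noncomputable def tangentDeriv (f : M → ℝ) (x : M) (v : TangentSpace 𝓘(ℝ, EM) x) : ℝ :=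
  mfderiv 𝓘(ℝ, EM) 𝓘(ℝ, ℝ) f x v

/-- A Lie algebroid structure on the vector bundle `E → M`: a smooth vector bundle map
`ρ : E → TM` over the identity (the anchor), and a Lie algebra structure on the sections of `E`
such that `[σ, f η] = (ρ(σ) f) η + f [σ, η]`. -/
structure LieAlgebroid where
  anchor : ∀ x, E x →ₗ[ℝ] TangentSpace 𝓘(ℝ, EM) x
  anchor_smooth : ContMDiff (𝓘(ℝ, EM).prod 𝓘(ℝ, F)) 𝓘(ℝ, EM).tangent ∞
    (fun v : TotalSpace F E => (⟨v.1, anchor v.1 v.2⟩ : TangentBundle 𝓘(ℝ, EM) M))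
  bracket : SmoothSection EM F E →ₗ[ℝ] SmoothSection EM F E →ₗ[ℝ] SmoothSection EM F E
  bracket_self : ∀ σ, bracket σ σ = 0
  jacobi : ∀ σ η ζ, bracket σ (bracket η ζ) + bracket η (bracket ζ σ) + bracket ζ (bracket σ η) = 0
  leibniz : ∀ (f : M → ℝ) (hf : ContMDiff 𝓘(ℝ, EM) 𝓘(ℝ, ℝ) ∞ f) (σ η : SmoothSection EM F E)
    (x : M), bracket σ (SmoothSection.funSMul f hf η) x
      = tangentDeriv f x (anchor x (σ x)) • η x + f x • bracket σ η x

/-- A smooth `k`-form on `E`, i.e. a smooth section of `⋀ᵏ E*`: an alternating `k`-linear form on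
each fibre, giving a smooth function when evaluated on smooth sections. -/
structure AlgebroidForm (k : ℕ) where
  toFun : ∀ x, E x [⋀^Fin k]→ₗ[ℝ] ℝ
  smooth : ∀ σ : Fin k → SmoothSection EM F E,
    ContMDiff 𝓘(ℝ, EM) 𝓘(ℝ, ℝ) ∞ (fun x => toFun x (fun i => σ i x))

variable {EM F E}

/-- The exterior differential of the Lie algebroid `A`, evaluated on sections:
`dθ(σ₀, …, σₖ) = ∑ᵢ (-1)ⁱ ρ(σᵢ)(θ(σ₀, …, σ̂ᵢ, …, σₖ))
  + ∑_{i<j} (-1)ⁱ⁺ʲ θ([σᵢ, σⱼ], σ₀, …, σ̂ᵢ, …, σ̂ⱼ, …, σₖ)`.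
In the code the bracket is left in the `i`-th slot instead of being moved to the front, which
absorbs a factor `(-1)ⁱ`. -/
noncomputable def LieAlgebroid.diff (A : LieAlgebroid EM F E) {k : ℕ}
    (θ : ∀ x, E x [⋀^Fin k]→ₗ[ℝ] ℝ) (σ : Fin (k + 1) → SmoothSection EM F E) (x : M) : ℝ :=
  (∑ i : Fin (k + 1), (-1 : ℝ) ^ (i : ℕ) *
      tangentDeriv (fun y => θ y (fun l => σ (i.succAbove l) y)) x (A.anchor x (σ i x)))
    + ∑ i : Fin (k + 1), ∑ j ∈ Finset.Ioi i, (-1 : ℝ) ^ (j : ℕ) *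
        θ x (fun l => Function.update σ i (A.bracket (σ i) (σ j)) (j.succAbove l) x)

/-- An `E`-path (admissible curve) on `[t₀, t₁]`: a `C¹` curve `a` in `E` whose base curve
`γ = τ ∘ a` satisfies `γ'(t) = ρ(a(t))`. -/
structure LieAlgebroid.IsPath (A : LieAlgebroid EM F E) (t₀ t₁ : ℝ) (a : ℝ → TotalSpace F E) :
    Prop where
  contMDiffOn : ContMDiffOn 𝓘(ℝ, ℝ) (𝓘(ℝ, EM).prod 𝓘(ℝ, F)) 1 a (Set.Icc t₀ t₁)
  admissible : ∀ t ∈ Set.Icc t₀ t₁,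
    HasMFDerivWithinAt 𝓘(ℝ, ℝ) 𝓘(ℝ, EM) (fun s => (a s).1) (Set.Icc t₀ t₁) t
      (ContinuousLinearMap.toSpanSingleton ℝ (A.anchor (a t).1 (a t).2 : EM) :
        TangentSpace 𝓘(ℝ, ℝ) t →L[ℝ] TangentSpace 𝓘(ℝ, EM) (a t).1)

/-- The expression `L(x, y)` of a function `L` on `E` in the fibred coordinates determined by a
coordinate system `φ` on `M` and a local basis `e` of sections of `E`. -/
noncomputable def localExpr (L : TotalSpace F E → ℝ) (φ : OpenPartialHomeomorph M EM) {n : ℕ}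
    (e : Fin n → SmoothSection EM F E) (p : EM × (Fin n → ℝ)) : ℝ :=
  L ⟨φ.symm p.1, ∑ α, p.2 α • e α (φ.symm p.1)⟩

/-- The curve `a` on `[t₀, t₁]` is a solution of Lagrange's equations for `L`: it is an `E`-path
and, in all fibred coordinates `(x, y)` determined by a coordinate system `φ` and a local basis
`e` of sections (over an open set `U`),
`d/dt (∂L/∂y^α) + (∂L/∂y^γ) C^γ_{αβ} y^β - ρ^i_α ∂L/∂x^i = 0` at all times `t` at which the base
curve is in the coordinate domain. Here `x(s)`, `y(s)` are the coordinates of `a(s)`,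
`[e_α, e_β] = C^γ_{αβ} e_γ`, and the vector `r α = (ρ^i_α)_i` is the coordinate expression of
`ρ(e_α)`. The members of `e` are global sections that form a basis over `U`; near any point each
local basis of sections is the restriction of such a family. -/
structure LieAlgebroid.IsLagrangeSolution (A : LieAlgebroid EM F E) (L : TotalSpace F E → ℝ)
    (t₀ t₁ : ℝ) (a : ℝ → TotalSpace F E) : Prop where
  isPath : A.IsPath t₀ t₁ a
  lagrange : ∀ φ ∈ IsManifold.maximalAtlas 𝓘(ℝ, EM) ∞ M,
    ∀ (n : ℕ) (e : Fin n → SmoothSection EM F E) (U : Set M) (_hU : IsOpen U)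
      (he : IsLocalFrameOn 𝓘(ℝ, EM) F ∞ (fun α x => e α x) U),
    ∀ t ∈ Set.Icc t₀ t₁, (a t).1 ∈ U → (a t).1 ∈ φ.source →
    let x : ℝ → EM := fun s => φ (a s).1
    let y : ℝ → Fin n → ℝ := fun s α => he.coeff α (a s).1 (a s).2
    let C : Fin n → Fin n → Fin n → ℝ := fun γ α β =>
      he.coeff γ (a t).1 (A.bracket (e α) (e β) (a t).1)
    let r : Fin n → EM := fun α =>
      mfderiv 𝓘(ℝ, EM) 𝓘(ℝ, EM) φ (a t).1 (A.anchor (a t).1 (e α (a t).1))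
    let Ly : Fin n → ℝ → ℝ := fun α s =>
      fderiv ℝ (localExpr L φ e) (x s, y s) (0, Pi.single α 1)
    ∀ α : Fin n, HasDerivWithinAt (Ly α)
      (fderiv ℝ (localExpr L φ e) (x t, y t) (r α, 0) - ∑ γ, ∑ β, Ly γ t * C γ α β * y t β)
      (Set.Icc t₀ t₁) t

end LieAlgebroids

section Morphisms

variable {EM : Type*} [NormedAddCommGroup EM] [NormedSpace ℝ EM]
  {M : Type*} [TopologicalSpace M] [ChartedSpace EM M]
  {F : Type*} [NormedAddCommGroup F] [NormedSpace ℝ F]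
  {E : M → Type*} [TopologicalSpace (TotalSpace F E)]
  [∀ x, AddCommGroup (E x)] [∀ x, Module ℝ (E x)] [∀ x, TopologicalSpace (E x)]
  [FiberBundle F E] [VectorBundle ℝ F E] [IsManifold 𝓘(ℝ, EM) ∞ M]
  {EM' : Type*} [NormedAddCommGroup EM'] [NormedSpace ℝ EM']
  {M' : Type*} [TopologicalSpace M'] [ChartedSpace EM' M']
  {F' : Type*} [NormedAddCommGroup F'] [NormedSpace ℝ F']
  {E' : M' → Type*} [TopologicalSpace (TotalSpace F' E')]
  [∀ x, AddCommGroup (E' x)] [∀ x, Module ℝ (E' x)] [∀ x, TopologicalSpace (E' x)]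
  [FiberBundle F' E'] [VectorBundle ℝ F' E'] [IsManifold 𝓘(ℝ, EM') ∞ M']

variable (EM F E EM' F' E') in
/-- A smooth vector bundle map `Φ : E → E'` over a smooth map `φ : M → M'`. -/
structure SmoothBundleMap where
  base : M → M'
  base_smooth : ContMDiff 𝓘(ℝ, EM) 𝓘(ℝ, EM') ∞ base
  fiber : ∀ x, E x →ₗ[ℝ] E' (base x)
  smooth : ContMDiff (𝓘(ℝ, EM).prod 𝓘(ℝ, F)) (𝓘(ℝ, EM').prod 𝓘(ℝ, F')) ∞
    (fun v : TotalSpace F E => (⟨base v.1, fiber v.1 v.2⟩ : TotalSpace F' E'))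

/-- The map of total spaces underlying a vector bundle map. -/
def SmoothBundleMap.total (Φ : SmoothBundleMap EM F E EM' F' E') (v : TotalSpace F E) :
    TotalSpace F' E' :=
  ⟨Φ.base v.1, Φ.fiber v.1 v.2⟩

/-- The pullback `Φ^⋆ θ` of a form. -/
def SmoothBundleMap.pullback (Φ : SmoothBundleMap EM F E EM' F' E') {k : ℕ}
    (θ : AlgebroidForm EM' F' E' k) (x : M) : E x [⋀^Fin k]→ₗ[ℝ] ℝ :=
  (θ.toFun (Φ.base x)).compLinearMap (Φ.fiber x)

/-- `Φ` is a morphism of Lie algebroids: `Φ^⋆ dθ = d Φ^⋆ θ` for all `p`-forms `θ` on `E'` and all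
`p`. At a point `x`, `(Φ^⋆ dθ)(σ₀(x), …, σₚ(x)) = (dθ)(Φ σ₀(x), …, Φ σₚ(x))`, which is
`dθ(s₀, …, sₚ)` at `φ(x)` for any sections `sᵢ` of `E'` with `sᵢ(φ(x)) = Φ σᵢ(x)`. -/
def SmoothBundleMap.IsMorphism (Φ : SmoothBundleMap EM F E EM' F' E')
    (A : LieAlgebroid EM F E) (A' : LieAlgebroid EM' F' E') : Prop :=
  ∀ (p : ℕ) (θ : AlgebroidForm EM' F' E' p) (σ : Fin (p + 1) → SmoothSection EM F E)
    (s : Fin (p + 1) → SmoothSection EM' F' E') (x : M),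
    (∀ i, s i (Φ.base x) = Φ.fiber x (σ i x)) →
      A'.diff θ.toFun s (Φ.base x) = A.diff (Φ.pullback θ) σ x

end Morphisms

/-! ### Cutoffs, frames of global sections, and fibred coordinates -/

section LocalFrames

variable {EM : Type*} [NormedAddCommGroup EM] [NormedSpace ℝ EM]
  {M : Type*} [TopologicalSpace M] [ChartedSpace EM M]
  {F : Type*} [NormedAddCommGroup F] [NormedSpace ℝ F]
  {E : M → Type*} [TopologicalSpace (TotalSpace F E)]
  [∀ x, AddCommGroup (E x)] [∀ x, Module ℝ (E x)] [∀ x, TopologicalSpace (E x)]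
  [FiberBundle F E] [VectorBundle ℝ F E]

open Topology

/-! In fibred coordinates let P be the matrix of Φ, and write (δL)_α for the left-hand side of
Lagrange's equations. The theorem rests on the identity (δL)_α = ∑ P^{α'}_α (δL')_{α'} along an
E-path. Surjectivity of Φ on fibres gives P a right inverse, so δL = 0 forces δL' = 0.

For the identity, the chain rule `SmoothBundleMap.fderiv_localExpr_comp_total` expresses ∂L/∂y and
the derivative of L along ρ(e_α) through L', with extra terms containing derivatives of P.
Differentiating ∂L/∂y^α = ∑ P^{α'}_α ∂L'/∂y'^{α'} in time gives further such terms, since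
admissibility turns d/dt into ρ(a). All of them cancel against the derivatives of P in the
transformation law of the structure functions; `lagrange_eq_of_lagrange_eq_comp` is this
cancellation.

The geometric input is the morphism condition in degrees 0 and 1 only. On functions it says that Φ
intertwines the anchors (`SmoothBundleMap.IsMorphism.mfderiv_base_anchor`), which also makes Φ ∘ a
admissible. On the coframe of a local frame it gives the transformation law
(`SmoothBundleMap.IsMorphism.coeff_bracket`). -/

/-- A smooth cutoff function, equal to `1` near `x` and supported in a neighbourhood `U` of `x`. -/
theorem exists_smooth_cutoff [FiniteDimensional ℝ EM] [T2Space M] [IsManifold 𝓘(ℝ, EM) ∞ M]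
    {x : M} {U : Set M} (hU : U ∈ 𝓝 x) :
    ∃ χ : M → ℝ, ContMDiff 𝓘(ℝ, EM) 𝓘(ℝ, ℝ) ∞ χ ∧ χ =ᶠ[𝓝 x] 1 ∧ tsupport χ ⊆ U := by
  obtain ⟨χ, -, hχ⟩ :=
    (SmoothBumpFunction.nhds_basis_tsupport (I := 𝓘(ℝ, EM)) x).mem_iff.1 hU
  exact ⟨χ, χ.contMDiff, χ.eventuallyEq_one, hχ⟩

/-- Near every point, a vector bundle has a local frame consisting of global smooth sections. -/
theorem exists_smoothSection_localFrame [FiniteDimensional ℝ EM] [T2Space M]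
    [IsManifold 𝓘(ℝ, EM) ∞ M] [FiniteDimensional ℝ F] [ContMDiffVectorBundle ∞ F E 𝓘(ℝ, EM)]
    (x : M) :
    ∃ (n : ℕ) (e : Fin n → SmoothSection EM F E) (U : Set M), IsOpen U ∧ x ∈ U ∧
      IsLocalFrameOn 𝓘(ℝ, EM) F ∞ (fun α y => e α y) U := by
  let T := trivializationAt F E x
  let b := Module.finBasis ℝ F
  have hx : x ∈ T.baseSet := mem_baseSet_trivializationAt F E x
  obtain ⟨χ, hχ, hχ1, hχT⟩ := exists_smooth_cutoff (EM := EM) (T.open_baseSet.mem_nhds hx)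
  obtain ⟨U, hU, hUo, hxU⟩ := eventually_nhds_iff.1
    (hχ1.and (T.open_baseSet.mem_nhds hx))
  have hf := T.isLocalFrameOn_localFrame_baseSet 𝓘(ℝ, EM) ∞ b
  -- The cutoff makes the local sections global and smooth, and leaves them unchanged on U, where χ
  -- = 1.
  refine ⟨_, fun α => ⟨fun y => χ y • T.localFrame b α y, ?_⟩, U, hUo, hxU, ?_⟩
  · have := ContMDiffOn.smul_section_of_tsupport (s := T.localFrame b α) hχ.contMDiffOn
      T.open_baseSet hχT (hf.contMDiffOn α)
    exact this
  · refine (hf.mono fun y hy => (hU y hy).2).congr fun α y hy => ?_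
    change _ = χ y • T.localFrame b α y
    rw [(hU y hy).1]
    simp

/-- The coefficients with respect to a local frame are smooth functions on the total space. -/
theorem IsLocalFrameOn.contMDiffAt_coeff_totalSpace [FiniteDimensional ℝ F]
    [IsManifold 𝓘(ℝ, EM) ∞ M] [ContMDiffVectorBundle ∞ F E 𝓘(ℝ, EM)] {n : ℕ}
    {e : Fin n → Π x : M, E x} {U : Set M} (he : IsLocalFrameOn 𝓘(ℝ, EM) F ∞ e U) (hU : IsOpen U)
    (α : Fin n) {v₀ : TotalSpace F E} (hv : v₀.1 ∈ U) :
    ContMDiffAt (𝓘(ℝ, EM).prod 𝓘(ℝ, F)) 𝓘(ℝ, ℝ) ∞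
      (fun v : TotalSpace F E => he.coeff α v.1 v.2) v₀ := by
  let T := trivializationAt F E v₀.1
  have hT : v₀.1 ∈ T.baseSet := mem_baseSet_trivializationAt F E v₀.1
  -- B x takes frame coefficients to the vector seen in the trivialization T. Hence the coefficients
  -- of v are the inverse of B applied to the fibre part of T v, and inversion is smooth at
  -- invertible maps.
  let B : M → ((Fin n → ℝ) →L[ℝ] F) := fun x =>
    ∑ β, (ContinuousLinearMap.proj β : (Fin n → ℝ) →L[ℝ] ℝ).smulRight (T ⟨x, e β x⟩).2
  have hB : ContMDiffAt 𝓘(ℝ, EM) 𝓘(ℝ, (Fin n → ℝ) →L[ℝ] F) ∞ B v₀.1 := by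
    apply ContMDiffAt.sum
    intro β _
    have h1 : ContMDiffAt 𝓘(ℝ, EM) 𝓘(ℝ, F) ∞ (fun x => (T ⟨x, e β x⟩).2) v₀.1 :=
      (contMDiffAt_section _).1 (he.contMDiffAt hU hv β)
    have h2 : ContDiff ℝ ∞ (fun w : F =>
        (ContinuousLinearMap.proj β : (Fin n → ℝ) →L[ℝ] ℝ).smulRight w) :=
      (ContinuousLinearMap.smulRightL ℝ (Fin n → ℝ) F
        (ContinuousLinearMap.proj β : (Fin n → ℝ) →L[ℝ] ℝ)).contDiff
    exact h2.contMDiff.contMDiffAt.comp _ h1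
  have hBe : ∀ x (_ : x ∈ U) (_ : x ∈ T.baseSet), ∃ B' : (Fin n → ℝ) ≃L[ℝ] F,
      (B' : (Fin n → ℝ) →L[ℝ] F) = B x ∧ ∀ w : E x, B'.symm (T ⟨x, w⟩).2 α = he.coeff α x w := by
    intro x hx hxT
    let B' := ((he.toBasisAt hx).equivFun.symm.trans
      (T.linearEquivAt ℝ x hxT)).toContinuousLinearEquiv
    refine ⟨B', ?_, fun w => ?_⟩
    · refine ContinuousLinearMap.coe_injective ?_
      refine LinearMap.pi_ext' fun β => LinearMap.ext_ring ?_
      simp [B, B', Pi.single_apply, T.linearEquivAt_apply]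
    · have h1 : he.coeff α x w = (he.toBasisAt hx).repr w α := by
        simp [IsLocalFrameOn.coeff, hx]
      rw [h1]
      change (he.toBasisAt hx).equivFun ((T.linearEquivAt ℝ x hxT).symm
        (T.linearEquivAt ℝ x hxT w)) α = _
      rw [LinearEquiv.symm_apply_apply]
      rfl
  have hmem : ∀ᶠ v in 𝓝 v₀, v.1 ∈ U ∧ v.1 ∈ T.baseSet :=
    (FiberBundle.continuous_proj F E).continuousAt.eventually
      ((hU.inter T.open_baseSet).mem_nhds ⟨hv, hT⟩)
  have hproj : ContMDiffAt (𝓘(ℝ, EM).prod 𝓘(ℝ, F)) 𝓘(ℝ, EM) ∞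
      (fun v : TotalSpace F E => v.1) v₀ := (contMDiff_proj E).contMDiffAt
  have hTv : ContMDiffAt (𝓘(ℝ, EM).prod 𝓘(ℝ, F)) 𝓘(ℝ, F) ∞
      (fun v : TotalSpace F E => (T v).2) v₀ := (contMDiffAt_totalSpace.1 contMDiffAt_id).2
  obtain ⟨B₀, hB₀, -⟩ := hBe v₀.1 hv hT
  have hinv : ContMDiffAt (𝓘(ℝ, EM).prod 𝓘(ℝ, F)) 𝓘(ℝ, F →L[ℝ] (Fin n → ℝ)) ∞
      (fun v : TotalSpace F E => (B v.1).inverse) v₀ := by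
    have h1 : ContDiffAt ℝ ∞ ContinuousLinearMap.inverse (B v₀.1) := by
      rw [← hB₀]; exact contDiffAt_map_inverse B₀
    exact ContMDiffAt.comp v₀ (h1.contMDiffAt) (hB.comp v₀ hproj)
  have := hinv.clm_apply hTv
  have h3 : ContDiff ℝ ∞ (fun w : Fin n → ℝ => w α) := contDiff_apply ℝ ℝ α
  refine (h3.contMDiff.contMDiffAt.comp v₀ this).congr_of_eventuallyEq ?_
  filter_upwards [hmem] with v hv
  obtain ⟨B', hB', h⟩ := hBe v.1 hv.1 hv.2
  simp only [Function.comp, ← hB', ContinuousLinearMap.inverse_equiv]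
  exact (h v.2).symm

omit [VectorBundle ℝ F E] in
theorem IsLocalFrameOn.sum_coeff_smul {n : ℕ} {e : Fin n → Π x : M, E x} {U : Set M}
    (he : IsLocalFrameOn 𝓘(ℝ, EM) F ∞ e U) {x : M} (hx : x ∈ U) (v : E x) :
    ∑ α, he.coeff α x v • e α x = v := by
  simpa [IsLocalFrameOn.coeff, hx] using (he.toBasisAt hx).sum_repr v

omit [VectorBundle ℝ F E] in
theorem IsLocalFrameOn.coeff_self {n : ℕ} {e : Fin n → Π x : M, E x} {U : Set M}
    (he : IsLocalFrameOn 𝓘(ℝ, EM) F ∞ e U) {x : M} (hx : x ∈ U) (α β : Fin n) :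
    he.coeff α x (e β x) = if β = α then 1 else 0 := by
  have := (he.toBasisAt hx).repr_self_apply β α
  simpa [IsLocalFrameOn.coeff, hx] using this

/-- In the fibred coordinates of a chart and a frame of global sections, a smooth function on the
total space is smooth. -/
theorem contDiffAt_localExpr [IsManifold 𝓘(ℝ, EM) ∞ M] [ContMDiffVectorBundle ∞ F E 𝓘(ℝ, EM)]
    {L : TotalSpace F E → ℝ}
    (hL : ContMDiff (𝓘(ℝ, EM).prod 𝓘(ℝ, F)) 𝓘(ℝ, ℝ) ∞ L) {φ : OpenPartialHomeomorph M EM}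
    (hφ : φ ∈ IsManifold.maximalAtlas 𝓘(ℝ, EM) ∞ M) {n : ℕ} (e : Fin n → SmoothSection EM F E)
    {p : EM × (Fin n → ℝ)} (hp : p.1 ∈ φ.target) : ContDiffAt ℝ ∞ (localExpr L φ e) p := by
  have hsymm : ContMDiffAt 𝓘(ℝ, EM × (Fin n → ℝ)) 𝓘(ℝ, EM) ∞
      (fun q : EM × (Fin n → ℝ) => φ.symm q.1) p :=
    (contMDiffAt_symm_of_mem_maximalAtlas hφ hp).comp p contDiff_fst.contMDiff.contMDiffAt
  rw [← contMDiffAt_iff_contDiffAt]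
  refine ContMDiffAt.comp p hL.contMDiffAt (f := fun q : EM × (Fin n → ℝ) =>
    (⟨φ.symm q.1, ∑ α, q.2 α • e α (φ.symm q.1)⟩ : TotalSpace F E)) ?_
  refine contMDiffAt_totalSpace.2 ⟨hsymm, ?_⟩
  let T := trivializationAt F E (φ.symm p.1)
  have hT : φ.symm p.1 ∈ T.baseSet := mem_baseSet_trivializationAt F E _
  -- T is linear on fibres, so near p this sum is the fibre component in T of the point with
  -- coordinates q.
  have hsum : ContMDiffAt 𝓘(ℝ, EM × (Fin n → ℝ)) 𝓘(ℝ, F) ∞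
      (fun q => ∑ α, q.2 α • (T ⟨φ.symm q.1, e α (φ.symm q.1)⟩).2) p := by
    refine ContMDiffAt.sum fun α _ => ?_
    have h1 : ContMDiffAt 𝓘(ℝ, EM) 𝓘(ℝ, F) ∞ (fun x => (T ⟨x, e α x⟩).2) (φ.symm p.1) :=
      (contMDiffAt_section _).1 (e α).contMDiff.contMDiffAt
    have h2 : ContDiff ℝ ∞ (fun q : EM × (Fin n → ℝ) => q.2 α) :=
      (contDiff_apply ℝ ℝ α).comp contDiff_snd
    exact h2.contMDiff.contMDiffAt.smul (ContMDiffAt.comp (g := fun x => (T ⟨x, e α x⟩).2) p h1 hsymm)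
  refine hsum.congr_of_eventuallyEq ?_
  filter_upwards [hsymm.continuousAt.eventually (T.open_baseSet.mem_nhds hT)] with q hq
  have : ∀ w : E (φ.symm q.1), (T ⟨φ.symm q.1, w⟩).2 = T.linearEquivAt ℝ _ hq w := fun _ => rfl
  change (T _).2 = _
  simp only [this, map_sum, map_smul]

/-- The derivative of the coordinate expression of `g`, in terms of the derivative of `g`. -/
theorem fderiv_comp_chart_symm [IsManifold 𝓘(ℝ, EM) ∞ M] {G : Type*} [NormedAddCommGroup G]
    [NormedSpace ℝ G] {φ : OpenPartialHomeomorph M EM}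
    (hφ : φ ∈ IsManifold.maximalAtlas 𝓘(ℝ, EM) ∞ M) {x : M} (hx : x ∈ φ.source) {g : M → G}
    (hg : MDifferentiableAt 𝓘(ℝ, EM) 𝓘(ℝ, G) g x) :
    DifferentiableAt ℝ (fun p => g (φ.symm p)) (φ x) ∧ ∀ v : TangentSpace 𝓘(ℝ, EM) x,
      fderiv ℝ (fun p => g (φ.symm p)) (φ x) (mfderiv 𝓘(ℝ, EM) 𝓘(ℝ, EM) φ x v)
        = mfderiv 𝓘(ℝ, EM) 𝓘(ℝ, G) g x v := by
  have h1 : MDifferentiableAt 𝓘(ℝ, EM) 𝓘(ℝ, EM) φ x :=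
    (contMDiffAt_of_mem_maximalAtlas hφ hx).mdifferentiableAt (by simp)
  have h2 : MDifferentiableAt 𝓘(ℝ, EM) 𝓘(ℝ, EM) φ.symm (φ x) :=
    (contMDiffAt_symm_of_mem_maximalAtlas hφ (φ.map_source hx)).mdifferentiableAt (by simp)
  have h3 : MDifferentiableAt 𝓘(ℝ, EM) 𝓘(ℝ, G) (fun p => g (φ.symm p)) (φ x) := by
    refine MDifferentiableAt.comp (φ x) ?_ h2
    rwa [φ.left_inv hx]
  refine ⟨h3.differentiableAt, fun v => ?_⟩
  have h4 : g =ᶠ[𝓝 x] (fun p => g (φ.symm p)) ∘ φ := by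
    filter_upwards [φ.open_source.mem_nhds hx] with y hy
    simp [φ.left_inv hy]
  rw [h4.mfderiv_eq, mfderiv_comp x h3 h1, mfderiv_eq_fderiv]
  rfl

end LocalFrames

/-! ### The exterior differential in degrees 0 and 1 -/

section Differential

open Topology

variable {EM : Type*} [NormedAddCommGroup EM] [NormedSpace ℝ EM]
  {M : Type*} [TopologicalSpace M] [ChartedSpace EM M]
  {F : Type*} [NormedAddCommGroup F] [NormedSpace ℝ F]
  {E : M → Type*} [TopologicalSpace (TotalSpace F E)]
  [∀ x, AddCommGroup (E x)] [∀ x, Module ℝ (E x)] [∀ x, TopologicalSpace (E x)]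
  [FiberBundle F E] [VectorBundle ℝ F E] [IsManifold 𝓘(ℝ, EM) ∞ M]

omit [IsManifold 𝓘(ℝ, EM) ∞ M] in
theorem SmoothSection.sum_smul_apply {n : ℕ} (c : Fin n → ℝ) (e : Fin n → SmoothSection EM F E)
    (x : M) : (∑ α, c α • e α : SmoothSection EM F E) x = ∑ α, c α • e α x := by
  have h := congrFun (map_sum (ContMDiffSection.coeAddHom 𝓘(ℝ, EM) F ∞ E)
    (fun α => c α • e α) Finset.univ) x
  rw [Finset.sum_apply] at h
  exact h

/-- A combination of a frame of global sections with constant coefficients suffices. It lets the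
morphism condition, stated on global sections, be tested on single vectors. -/
theorem exists_smoothSection_eq [FiniteDimensional ℝ EM] [T2Space M]
    [FiniteDimensional ℝ F] [ContMDiffVectorBundle ∞ F E 𝓘(ℝ, EM)] {x : M} (v : E x) :
    ∃ σ : SmoothSection EM F E, σ x = v := by
  obtain ⟨n, e, U, -, hx, he⟩ := exists_smoothSection_localFrame (EM := EM) (F := F) (E := E) x
  exact ⟨∑ α, he.coeff α x v • e α, by
    rw [SmoothSection.sum_smul_apply]; exact he.sum_coeff_smul hx v⟩

omit [IsManifold 𝓘(ℝ, EM) ∞ M] in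
theorem tangentDeriv_congr {f g : M → ℝ} {x : M} (h : f =ᶠ[𝓝 x] g)
    (v : TangentSpace 𝓘(ℝ, EM) x) : tangentDeriv f x v = tangentDeriv g x v := by
  unfold tangentDeriv
  rw [h.mfderiv_eq]
  rfl

omit [IsManifold 𝓘(ℝ, EM) ∞ M] in
theorem tangentDeriv_of_eventually_const {f : M → ℝ} {x : M} {c : ℝ} (h : ∀ᶠ y in 𝓝 x, f y = c)
    (v : TangentSpace 𝓘(ℝ, EM) x) : tangentDeriv f x v = 0 := by
  rw [tangentDeriv_congr (g := fun _ => c) h]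
  simp only [tangentDeriv, mfderiv_const]
  rfl

/-- Degree 0 sees only the anchor; this is the form in which the morphism condition is applied to
functions. -/
theorem LieAlgebroid.diff_zero_form (A : LieAlgebroid EM F E) {θ : ∀ x, E x [⋀^Fin 0]→ₗ[ℝ] ℝ}
    {f : M → ℝ} (h : ∀ x w, θ x w = f x) (σ : Fin 1 → SmoothSection EM F E) (x : M) :
    A.diff θ σ x = tangentDeriv f x (A.anchor x (σ 0 x)) := by
  simp [LieAlgebroid.diff, h]

/-- Degree 1 is the first in which the bracket appears. The only pair is i = 0, j = 1, with sign -1.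
-/
theorem LieAlgebroid.diff_one_form (A : LieAlgebroid EM F E) {θ : ∀ x, E x [⋀^Fin 1]→ₗ[ℝ] ℝ}
    {l : ∀ x, E x →ₗ[ℝ] ℝ} (h : ∀ x w, θ x w = l x (w 0)) (σ : Fin 2 → SmoothSection EM F E)
    (x : M) :
    A.diff θ σ x = tangentDeriv (fun y => l y (σ 1 y)) x (A.anchor x (σ 0 x))
      - tangentDeriv (fun y => l y (σ 0 y)) x (A.anchor x (σ 1 x))
      - l x (A.bracket (σ 0) (σ 1) x) := by
  have h0 : (Finset.Ioi 0 : Finset (Fin 2)) = {1} := by decide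
  have h1 : (Finset.Ioi 1 : Finset (Fin 2)) = ∅ := by decide
  simp [LieAlgebroid.diff, h, Fin.sum_univ_two, h0, h1]
  ring

end Differential

/-! ### Morphisms respect anchors and brackets -/

section MorphismProperties

open Topology

variable {EM : Type*} [NormedAddCommGroup EM] [NormedSpace ℝ EM] [FiniteDimensional ℝ EM]
  {M : Type*} [TopologicalSpace M] [ChartedSpace EM M] [IsManifold 𝓘(ℝ, EM) ∞ M] [T2Space M]
  {F : Type*} [NormedAddCommGroup F] [NormedSpace ℝ F] [FiniteDimensional ℝ F]
  {E : M → Type*} [TopologicalSpace (TotalSpace F E)]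
  [∀ x, AddCommGroup (E x)] [∀ x, Module ℝ (E x)] [∀ x, TopologicalSpace (E x)]
  [FiberBundle F E] [VectorBundle ℝ F E] [ContMDiffVectorBundle ∞ F E 𝓘(ℝ, EM)]
  {EM' : Type*} [NormedAddCommGroup EM'] [NormedSpace ℝ EM'] [FiniteDimensional ℝ EM']
  {M' : Type*} [TopologicalSpace M'] [ChartedSpace EM' M'] [IsManifold 𝓘(ℝ, EM') ∞ M']
  [T2Space M']
  {F' : Type*} [NormedAddCommGroup F'] [NormedSpace ℝ F'] [FiniteDimensional ℝ F']
  {E' : M' → Type*} [TopologicalSpace (TotalSpace F' E')]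
  [∀ x, AddCommGroup (E' x)] [∀ x, Module ℝ (E' x)] [∀ x, TopologicalSpace (E' x)]
  [FiberBundle F' E'] [VectorBundle ℝ F' E'] [ContMDiffVectorBundle ∞ F' E' 𝓘(ℝ, EM')]
  {A : LieAlgebroid EM F E} {A' : LieAlgebroid EM' F' E'}
  {Φ : SmoothBundleMap EM F E EM' F' E'}

/-- A morphism of Lie algebroids is compatible with the anchors. -/
theorem SmoothBundleMap.IsMorphism.mfderiv_base_anchor (hΦ : Φ.IsMorphism A A') (x : M) (v : E x) :
    mfderiv 𝓘(ℝ, EM) 𝓘(ℝ, EM') Φ.base x (A.anchor x v)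
      = A'.anchor (Φ.base x) (Φ.fiber x v) := by
  -- The morphism condition for the 0-form f: the two tangent vectors have the same derivative on
  -- every smooth function.
  have key : ∀ f : M' → ℝ, ContMDiff 𝓘(ℝ, EM') 𝓘(ℝ, ℝ) ∞ f →
      mfderiv 𝓘(ℝ, EM') 𝓘(ℝ, ℝ) f (Φ.base x) (A'.anchor (Φ.base x) (Φ.fiber x v))
        = mfderiv 𝓘(ℝ, EM') 𝓘(ℝ, ℝ) f (Φ.base x)
          (mfderiv 𝓘(ℝ, EM) 𝓘(ℝ, EM') Φ.base x (A.anchor x v)) := by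
    intro f hf
    obtain ⟨σ, hσ⟩ := exists_smoothSection_eq (EM := EM) (F := F) v
    obtain ⟨s, hs⟩ := exists_smoothSection_eq (EM := EM') (F := F') (Φ.fiber x v)
    let θ : AlgebroidForm EM' F' E' 0 :=
      ⟨fun y => AlternatingMap.constOfIsEmpty ℝ (E' y) (Fin 0) (f y), fun _ => hf⟩
    have h := hΦ 0 θ (fun _ => σ) (fun _ => s) x (fun _ => by rw [hs, hσ])
    rw [A'.diff_zero_form (f := f) (fun _ _ => rfl),
      A.diff_zero_form (f := f ∘ Φ.base) (fun _ _ => rfl), hs, hσ] at h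
    unfold tangentDeriv at h
    rw [mfderiv_comp x (hf.contMDiffAt.mdifferentiableAt (by simp))
      (Φ.base_smooth.contMDiffAt.mdifferentiableAt (by simp))] at h
    exact h
  let y := Φ.base x
  have hy : y ∈ (chartAt EM' y).source := mem_chart_source EM' y
  have hinj := (mdifferentiable_chart (I := 𝓘(ℝ, EM')) y).mfderiv_injective hy
  obtain ⟨χ, hχ, hχ1, hχT⟩ := exists_smooth_cutoff (EM := EM')
    ((chartAt EM' y).open_source.mem_nhds hy)
  have hch : ∀ z ∈ (chartAt EM' y).source,
      ContMDiffAt 𝓘(ℝ, EM') 𝓘(ℝ, EM') ∞ (chartAt EM' y) z := fun z hz =>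
    contMDiffAt_of_mem_maximalAtlas (IsManifold.chart_mem_maximalAtlas y) hz
  -- It suffices to compare the vectors in a chart, where linear functionals separate points. Each
  -- functional of the chart, cut off near y, is a global test function for `key`.
  refine hinj ?_
  refine (SeparatingDual.eq_iff_forall_dual_eq (R := ℝ) (V := EM')).2 fun l => ?_
  have hf : ContMDiff 𝓘(ℝ, EM') 𝓘(ℝ, ℝ) ∞ (fun z => χ z • l (chartAt EM' y z)) := by
    refine contMDiff_of_tsupport fun z hz => ?_
    have hz' := hχT (tsupport_smul_subset_left _ _ hz)
    exact hχ.contMDiffAt.smul (l.contDiff.contMDiff.contMDiffAt.comp z (hch z hz'))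
  have hd : mfderiv 𝓘(ℝ, EM') 𝓘(ℝ, ℝ) (fun z => χ z • l (chartAt EM' y z)) y
      = l.comp (mfderiv 𝓘(ℝ, EM') 𝓘(ℝ, EM') (chartAt EM' y) y) := by
    have h1 : (fun z => χ z • l (chartAt EM' y z)) =ᶠ[𝓝 y] l ∘ (chartAt EM' y) := by
      filter_upwards [hχ1] with z hz
      simp [hz]
    rw [h1.mfderiv_eq, mfderiv_comp y l.differentiableAt.mdifferentiableAt
      ((hch y hy).mdifferentiableAt (by simp)), mfderiv_eq_fderiv, l.fderiv]
    rfl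
  have := key _ hf
  change mfderiv 𝓘(ℝ, EM') 𝓘(ℝ, ℝ) (fun z => χ z • l (chartAt EM' y z)) y _
    = mfderiv 𝓘(ℝ, EM') 𝓘(ℝ, ℝ) (fun z => χ z • l (chartAt EM' y z)) y _ at this
  rw [hd] at this
  exact this.symm

omit [FiniteDimensional ℝ EM] [T2Space M] [FiniteDimensional ℝ F]
  [ContMDiffVectorBundle ∞ F E 𝓘(ℝ, EM)] in
/-- A morphism of Lie algebroids is compatible with the brackets: the components of `Φ [σ, η]`
with respect to a local frame. -/
theorem SmoothBundleMap.IsMorphism.coeff_bracket (hΦ : Φ.IsMorphism A A') {n : ℕ}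
    {e : Fin n → SmoothSection EM' F' E'} {U : Set M'} (hU : IsOpen U)
    (he : IsLocalFrameOn 𝓘(ℝ, EM') F' ∞ (fun α y => e α y) U) {x : M} (hx : Φ.base x ∈ U)
    (σ η : SmoothSection EM F E) (γ : Fin n) :
    he.coeff γ (Φ.base x) (Φ.fiber x (A.bracket σ η x))
      = tangentDeriv (fun y => he.coeff γ (Φ.base y) (Φ.fiber y (η y))) x (A.anchor x (σ x))
        - tangentDeriv (fun y => he.coeff γ (Φ.base y) (Φ.fiber y (σ y))) x (A.anchor x (η x))
        + ∑ α, ∑ β, he.coeff α (Φ.base x) (Φ.fiber x (σ x)) *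
            he.coeff β (Φ.base x) (Φ.fiber x (η x)) *
            he.coeff γ (Φ.base x) (A'.bracket (e α) (e β) (Φ.base x)) := by
  obtain ⟨χ, hχ, hχ1, hχT⟩ := exists_smooth_cutoff (EM := EM') (hU.mem_nhds hx)
  have hχx : χ (Φ.base x) = 1 := hχ1.eq_of_nhds
  -- The γ-th element of the dual frame, cut off to become a global 1-form.
  let l : ∀ y, E' y →ₗ[ℝ] ℝ := fun y => χ y • he.coeff γ y
  let θ : AlgebroidForm EM' F' E' 1 :=
    ⟨fun y => AlternatingMap.ofSubsingleton ℝ (E' y) ℝ (0 : Fin 1) (l y), fun s => by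
      change ContMDiff 𝓘(ℝ, EM') 𝓘(ℝ, ℝ) ∞ (fun y => χ y • he.coeff γ y (s 0 y))
      refine contMDiff_of_tsupport fun z hz => ?_
      have hz' := hχT (tsupport_smul_subset_left _ _ hz)
      refine hχ.contMDiffAt.smul ?_
      exact ContMDiffAt.comp z (g := fun v : TotalSpace F' E' => he.coeff γ v.1 v.2)
        (he.contMDiffAt_coeff_totalSpace hU γ (v₀ := ⟨z, s 0 z⟩) hz') (s 0).contMDiff.contMDiffAt⟩
  -- The sections of E' extending Φσ(x) and Φη(x) are given constant coefficients in the frame. The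
  -- two derivative terms on the E' side then vanish, leaving only the structure functions there.
  let c : Fin 2 → Fin n → ℝ := fun i α =>
    he.coeff α (Φ.base x) (Φ.fiber x ((![σ, η] : Fin 2 → SmoothSection EM F E) i x))
  let s : Fin 2 → SmoothSection EM' F' E' := fun i => ∑ α, c i α • e α
  have hs : ∀ i, s i (Φ.base x) = Φ.fiber x ((![σ, η] : Fin 2 → SmoothSection EM F E) i x) := by
    intro i
    rw [SmoothSection.sum_smul_apply]
    exact he.sum_coeff_smul hx _
  have h := hΦ 1 θ ![σ, η] s x hs
  rw [A'.diff_one_form (l := l) (fun _ _ => rfl),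
    A.diff_one_form (l := fun y => (l (Φ.base y)).comp (Φ.fiber y)) (fun _ _ => rfl)] at h
  have hconst : ∀ i, ∀ᶠ y in 𝓝 (Φ.base x), l y (s i y) = c i γ := by
    intro i
    filter_upwards [hχ1, hU.mem_nhds hx] with y hy hyU
    rw [SmoothSection.sum_smul_apply]
    have : ∀ β, he.coeff γ y (e β y) = if β = γ then 1 else 0 := fun β => he.coeff_self hyU γ β
    simp [l, hy, this]
  rw [tangentDeriv_of_eventually_const (hconst 0), tangentDeriv_of_eventually_const (hconst 1)]
    at h
  have hnear : ∀ᶠ y in 𝓝 x, χ (Φ.base y) = 1 :=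
    Φ.base_smooth.continuous.continuousAt.eventually hχ1
  have hcongr : ∀ ζ : SmoothSection EM F E,
      (fun y => ((l (Φ.base y)).comp (Φ.fiber y)) (ζ y)) =ᶠ[𝓝 x]
        fun y => he.coeff γ (Φ.base y) (Φ.fiber y (ζ y)) := by
    intro ζ
    filter_upwards [hnear] with y hy
    simp [l, hy]
  have hbr : A'.bracket (s 0) (s 1) (Φ.base x)
      = ∑ α, ∑ β, (c 0 α * c 1 β) • A'.bracket (e α) (e β) (Φ.base x) := by
    have h1 : A'.bracket (s 0) (s 1) = ∑ α, c 0 α • ∑ β, c 1 β • A'.bracket (e α) (e β) := by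
      simp only [s, map_sum, map_smul, LinearMap.sum_apply, LinearMap.smul_apply, Finset.smul_sum]
      rw [Finset.sum_comm]
      exact Finset.sum_congr rfl fun α _ => Finset.sum_congr rfl fun β _ => smul_comm _ _ _
    rw [h1, SmoothSection.sum_smul_apply]
    simp only [SmoothSection.sum_smul_apply, Finset.smul_sum, smul_smul]
  simp only [Matrix.cons_val_zero, Matrix.cons_val_one] at h
  rw [tangentDeriv_congr (hcongr σ), tangentDeriv_congr (hcongr η), hbr] at h
  simp only [l, map_sum, LinearMap.comp_apply, map_smul, hχx, one_smul,
    smul_eq_mul] at h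
  simp only [c, Matrix.cons_val_zero, Matrix.cons_val_one] at h
  linarith

end MorphismProperties

/-! ### Differentiation along curves -/

section Curves

open Topology

variable {EM : Type*} [NormedAddCommGroup EM] [NormedSpace ℝ EM]
  {M : Type*} [TopologicalSpace M] [ChartedSpace EM M] [IsManifold 𝓘(ℝ, EM) ∞ M]
  {F : Type*} [NormedAddCommGroup F] [NormedSpace ℝ F] [FiniteDimensional ℝ F]
  {E : M → Type*} [TopologicalSpace (TotalSpace F E)]
  [∀ x, AddCommGroup (E x)] [∀ x, Module ℝ (E x)] [∀ x, TopologicalSpace (E x)]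
  [FiberBundle F E] [VectorBundle ℝ F E] [ContMDiffVectorBundle ∞ F E 𝓘(ℝ, EM)]

/-- The partial derivatives of a smooth function in fibred coordinates are differentiable along a
`C¹` curve in the total space. -/
theorem differentiableWithinAt_fderiv_localExpr {L : TotalSpace F E → ℝ}
    (hL : ContMDiff (𝓘(ℝ, EM).prod 𝓘(ℝ, F)) 𝓘(ℝ, ℝ) ∞ L) {φ : OpenPartialHomeomorph M EM}
    (hφ : φ ∈ IsManifold.maximalAtlas 𝓘(ℝ, EM) ∞ M) {n : ℕ} {e : Fin n → SmoothSection EM F E}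
    {U : Set M} (hU : IsOpen U) (he : IsLocalFrameOn 𝓘(ℝ, EM) F ∞ (fun α x => e α x) U)
    {b : ℝ → TotalSpace F E} {S : Set ℝ} {t : ℝ}
    (hb : ContMDiffWithinAt 𝓘(ℝ, ℝ) (𝓘(ℝ, EM).prod 𝓘(ℝ, F)) 1 b S t) (htU : (b t).1 ∈ U)
    (htφ : (b t).1 ∈ φ.source) (w : EM × (Fin n → ℝ)) :
    DifferentiableWithinAt ℝ (fun s => fderiv ℝ (localExpr L φ e)
      (φ (b s).1, fun α => he.coeff α (b s).1 (b s).2) w) S t := by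
  have hx : ContMDiffWithinAt 𝓘(ℝ, ℝ) 𝓘(ℝ, EM) 1 (fun s => φ (b s).1) S t := by
    have h1 : ContMDiffAt (𝓘(ℝ, EM).prod 𝓘(ℝ, F)) 𝓘(ℝ, EM) 1
        (fun v : TotalSpace F E => φ v.1) (b t) :=
      ((contMDiffAt_of_mem_maximalAtlas hφ htφ).comp (b t)
        (contMDiff_proj E).contMDiffAt).of_le (by simp)
    exact h1.comp_contMDiffWithinAt t hb
  have hy : ∀ α, ContMDiffWithinAt 𝓘(ℝ, ℝ) 𝓘(ℝ, ℝ) 1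
      (fun s => he.coeff α (b s).1 (b s).2) S t := fun α =>
    ((he.contMDiffAt_coeff_totalSpace hU α htU).of_le (by simp)).comp_contMDiffWithinAt t hb
  have hxy : DifferentiableWithinAt ℝ
      (fun s => (φ (b s).1, fun α => he.coeff α (b s).1 (b s).2)) S t :=
    (hx.contDiffWithinAt.differentiableWithinAt (by simp)).prodMk
      (differentiableWithinAt_pi.2 fun α =>
        (hy α).contDiffWithinAt.differentiableWithinAt (by simp))
  have hl : ContDiffAt ℝ 1 (fderiv ℝ (localExpr L φ e))
      (φ (b t).1, fun α => he.coeff α (b t).1 (b t).2) :=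
    (contDiffAt_localExpr hL hφ e (φ.map_source htφ)).fderiv_right
      (WithTop.coe_le_coe.2 le_top : ((1 + 1 : ℕ∞) : WithTop ℕ∞) ≤ ∞)
  exact DifferentiableWithinAt.clm_apply
    ((hl.differentiableAt (by simp)).comp_differentiableWithinAt t hxy)
    (differentiableWithinAt_const w)

omit [FiniteDimensional ℝ F] [ContMDiffVectorBundle ∞ F E 𝓘(ℝ, EM)] in
/-- The derivative of a function along the base curve of an `E`-path. -/
theorem LieAlgebroid.IsPath.hasDerivWithinAt_comp {A : LieAlgebroid EM F E} {t₀ t₁ : ℝ}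
    {a : ℝ → TotalSpace F E} (ha : A.IsPath t₀ t₁ a) {t : ℝ} (ht : t ∈ Set.Icc t₀ t₁)
    {f : M → ℝ} (hf : MDifferentiableAt 𝓘(ℝ, EM) 𝓘(ℝ, ℝ) f (a t).1) :
    HasDerivWithinAt (fun s => f (a s).1) (tangentDeriv f (a t).1 (A.anchor (a t).1 (a t).2))
      (Set.Icc t₀ t₁) t := by
  have h := HasMFDerivAt.comp_hasMFDerivWithinAt t hf.hasMFDerivAt (ha.admissible t ht)
  have h' : HasFDerivWithinAt (fun s => f (a s).1)
      (ContinuousLinearMap.toSpanSingleton ℝ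
        (tangentDeriv f (a t).1 (A.anchor (a t).1 (a t).2)) : ℝ →L[ℝ] ℝ) (Set.Icc t₀ t₁) t := by
    refine (hasMFDerivWithinAt_iff_hasFDerivWithinAt.1 h).congr_fderiv ?_
    refine ContinuousLinearMap.ext fun r => ?_
    exact (mfderiv 𝓘(ℝ, EM) 𝓘(ℝ, ℝ) f (a t).1).map_smul r (A.anchor (a t).1 (a t).2)
  simpa using h'.hasDerivWithinAt

end Curves

/-! ### Bundle maps in fibred coordinates -/

section BundleMaps

open Topology

variable {EM : Type*} [NormedAddCommGroup EM] [NormedSpace ℝ EM]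
  {M : Type*} [TopologicalSpace M] [ChartedSpace EM M] [IsManifold 𝓘(ℝ, EM) ∞ M]
  {F : Type*} [NormedAddCommGroup F] [NormedSpace ℝ F]
  {E : M → Type*} [TopologicalSpace (TotalSpace F E)]
  [∀ x, AddCommGroup (E x)] [∀ x, Module ℝ (E x)] [∀ x, TopologicalSpace (E x)]
  [FiberBundle F E] [VectorBundle ℝ F E]
  {EM' : Type*} [NormedAddCommGroup EM'] [NormedSpace ℝ EM']
  {M' : Type*} [TopologicalSpace M'] [ChartedSpace EM' M'] [IsManifold 𝓘(ℝ, EM') ∞ M']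
  {F' : Type*} [NormedAddCommGroup F'] [NormedSpace ℝ F'] [FiniteDimensional ℝ F']
  {E' : M' → Type*} [TopologicalSpace (TotalSpace F' E')]
  [∀ x, AddCommGroup (E' x)] [∀ x, Module ℝ (E' x)] [∀ x, TopologicalSpace (E' x)]
  [FiberBundle F' E'] [VectorBundle ℝ F' E'] [ContMDiffVectorBundle ∞ F' E' 𝓘(ℝ, EM')]

/-- The matrix of a bundle map with respect to sections `e` of `E` and a local frame `e'`
of `E'`. -/
noncomputable def SmoothBundleMap.frameMatrix (Φ : SmoothBundleMap EM F E EM' F' E') {n n' : ℕ}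
    (e : Fin n → SmoothSection EM F E) {e' : Fin n' → SmoothSection EM' F' E'} {U' : Set M'}
    (he' : IsLocalFrameOn 𝓘(ℝ, EM') F' ∞ (fun α x => e' α x) U') (α' : Fin n') (α : Fin n)
    (x : M) : ℝ :=
  he'.coeff α' (Φ.base x) (Φ.fiber x (e α x))

variable (Φ : SmoothBundleMap EM F E EM' F' E') {n n' : ℕ} (e : Fin n → SmoothSection EM F E)
  {e' : Fin n' → SmoothSection EM' F' E'} {U' : Set M'} (hU' : IsOpen U')
  (he' : IsLocalFrameOn 𝓘(ℝ, EM') F' ∞ (fun α x => e' α x) U')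

omit [IsManifold 𝓘(ℝ, EM) ∞ M] [VectorBundle ℝ F E] in
include hU' in
theorem SmoothBundleMap.mdifferentiableAt_frameMatrix {x : M} (hx : Φ.base x ∈ U') (α' : Fin n')
    (α : Fin n) : MDifferentiableAt 𝓘(ℝ, EM) 𝓘(ℝ, ℝ) (Φ.frameMatrix e he' α' α) x := by
  have h1 : ContMDiffAt 𝓘(ℝ, EM) (𝓘(ℝ, EM').prod 𝓘(ℝ, F')) ∞
      (fun y => Φ.total ⟨y, e α y⟩) x := Φ.smooth.contMDiffAt.comp x (e α).contMDiff.contMDiffAt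
  exact ((he'.contMDiffAt_coeff_totalSpace hU' α' (v₀ := Φ.total ⟨x, e α x⟩) hx).comp x
    h1).mdifferentiableAt (by simp)

omit [IsManifold 𝓘(ℝ, EM) ∞ M] [VectorBundle ℝ F E] [IsManifold 𝓘(ℝ, EM') ∞ M']
  [VectorBundle ℝ F' E'] [FiniteDimensional ℝ F']
  [ContMDiffVectorBundle ∞ F' E' 𝓘(ℝ, EM')] in
theorem SmoothBundleMap.coeff_fiber_sum (c : Fin n → ℝ) (α' : Fin n') (x : M) :
    he'.coeff α' (Φ.base x) (Φ.fiber x (∑ α, c α • e α x))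
      = ∑ α, c α * Φ.frameMatrix e he' α' α x := by
  simp [SmoothBundleMap.frameMatrix, map_sum]

omit [VectorBundle ℝ F E] in
include hU' in
/-- The chain rule for the pullback `L' ∘ Φ`, in fibred coordinates. -/
theorem SmoothBundleMap.fderiv_localExpr_comp_total {L' : TotalSpace F' E' → ℝ}
    (hL' : ContMDiff (𝓘(ℝ, EM').prod 𝓘(ℝ, F')) 𝓘(ℝ, ℝ) ∞ L')
    {ψ : OpenPartialHomeomorph M EM} (hψ : ψ ∈ IsManifold.maximalAtlas 𝓘(ℝ, EM) ∞ M)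
    {ψ' : OpenPartialHomeomorph M' EM'} (hψ' : ψ' ∈ IsManifold.maximalAtlas 𝓘(ℝ, EM') ∞ M')
    {x : M} (hx : x ∈ ψ.source) (hxU' : Φ.base x ∈ U') (hx' : Φ.base x ∈ ψ'.source)
    (y w : Fin n → ℝ) (u : TangentSpace 𝓘(ℝ, EM) x) :
    let ξ' : EM' × (Fin n' → ℝ) :=
      (ψ' (Φ.base x), fun α' => ∑ α, y α * Φ.frameMatrix e he' α' α x)
    fderiv ℝ (localExpr (L' ∘ Φ.total) ψ e) (ψ x, y) (mfderiv 𝓘(ℝ, EM) 𝓘(ℝ, EM) ψ x u, w)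
      = fderiv ℝ (localExpr L' ψ' e') ξ'
          (mfderiv 𝓘(ℝ, EM') 𝓘(ℝ, EM') ψ' (Φ.base x)
            (mfderiv 𝓘(ℝ, EM) 𝓘(ℝ, EM') Φ.base x u), 0)
        + ∑ α', (∑ α, (y α * tangentDeriv (Φ.frameMatrix e he' α' α) x u
            + Φ.frameMatrix e he' α' α x * w α))
          * fderiv ℝ (localExpr L' ψ' e') ξ' (0, Pi.single α' 1) := by
  intro ξ'
  -- K is Φ in coordinates. It is linear in the fibre variable with matrix depending on the base
  -- point, which is the source of the derivatives of P.
  let K : EM × (Fin n → ℝ) → EM' × (Fin n' → ℝ) := fun p =>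
    (ψ' (Φ.base (ψ.symm p.1)), fun α' => ∑ α, p.2 α * Φ.frameMatrix e he' α' α (ψ.symm p.1))
  have hbase : MDifferentiableAt 𝓘(ℝ, EM) 𝓘(ℝ, EM') Φ.base x :=
    Φ.base_smooth.contMDiffAt.mdifferentiableAt (by simp)
  have hchart' : MDifferentiableAt 𝓘(ℝ, EM') 𝓘(ℝ, EM') ψ' (Φ.base x) :=
    (contMDiffAt_of_mem_maximalAtlas hψ' hx').mdifferentiableAt (by simp)
  obtain ⟨hf, hfd⟩ := fderiv_comp_chart_symm hψ hx (g := fun z => ψ' (Φ.base z))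
    (hchart'.comp x hbase)
  have hP := fun α' α => fderiv_comp_chart_symm hψ hx
    (Φ.mdifferentiableAt_frameMatrix e hU' he' hxU' α' α)
  have hK := (hf.hasFDerivAt.comp (ψ x, y) hasFDerivAt_fst).prodMk
    (hasFDerivAt_pi.2 fun α' => HasFDerivAt.fun_sum (u := Finset.univ) fun α _ =>
      (((ContinuousLinearMap.proj (R := ℝ) (φ := fun _ : Fin n => ℝ) α).comp
        (ContinuousLinearMap.snd ℝ EM (Fin n → ℝ))).hasFDerivAt (x := (ψ x, y))).mul
      ((hP α' α).1.hasFDerivAt.comp (ψ x, y) hasFDerivAt_fst))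
  have hKx : K (ψ x, y) = ξ' := by simp [K, ξ', ψ.left_inv hx]
  have hl : DifferentiableAt ℝ (localExpr L' ψ' e') (K (ψ x, y)) := by
    rw [hKx]
    exact (contDiffAt_localExpr hL' hψ' e' (ψ'.map_source hx')).differentiableAt (by simp)
  -- This holds only near the point: the base image must stay in U' and in the domain of ψ'.
  have hev : localExpr (L' ∘ Φ.total) ψ e =ᶠ[𝓝 (ψ x, y)] localExpr L' ψ' e' ∘ K := by
    have hc : ContinuousAt (fun p : EM × (Fin n → ℝ) => Φ.base (ψ.symm p.1)) (ψ x, y) := by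
      refine ContinuousAt.comp (g := Φ.base) Φ.base_smooth.continuous.continuousAt ?_
      exact ContinuousAt.comp (g := ψ.symm) (ψ.continuousAt_symm (ψ.map_source hx))
        continuousAt_fst
    filter_upwards [hc.eventually ((hU'.inter ψ'.open_source).mem_nhds
      (by simpa [ψ.left_inv hx] using ⟨hxU', hx'⟩))] with p hp
    simp only [localExpr, Function.comp, SmoothBundleMap.total, K, ← Φ.coeff_fiber_sum e he']
    rw [ψ'.left_inv hp.2, he'.sum_coeff_smul hp.1]
  have hd := hev.fderiv_eq.trans (hl.hasFDerivAt.comp (ψ x, y) hK).fderiv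
  rw [hd, hKx]
  have hsplit : ∀ (p : EM') (q : Fin n' → ℝ), fderiv ℝ (localExpr L' ψ' e') ξ' (p, q)
      = fderiv ℝ (localExpr L' ψ' e') ξ' (p, 0)
        + ∑ α', q α' * fderiv ℝ (localExpr L' ψ' e') ξ' (0, Pi.single α' 1) := by
    intro p q
    have h1 : (p, q) = (p, (0 : Fin n' → ℝ))
        + ∑ α', q α' • ((0 : EM'), (Pi.single α' 1 : Fin n' → ℝ)) := by
      refine Prod.ext ?_ ?_
      · simp [Prod.fst_sum]
      · ext β
        simp [Prod.snd_sum, Finset.sum_apply, Pi.single_apply]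
    rw [h1, map_add, map_sum]
    simp only [map_smul, smul_eq_mul]
  have hfu := hfd u
  rw [show mfderiv 𝓘(ℝ, EM) 𝓘(ℝ, EM') (fun z => ψ' (Φ.base z)) x u
    = mfderiv 𝓘(ℝ, EM') 𝓘(ℝ, EM') ψ' (Φ.base x) (mfderiv 𝓘(ℝ, EM) 𝓘(ℝ, EM') Φ.base x u) from
    congrArg (fun D => D u) (mfderiv_comp x hchart' hbase)] at hfu
  refine (hsplit _ _).trans ?_
  congr 1
  · refine congrArg (fun p => fderiv ℝ (localExpr L' ψ' e') ξ' (p, 0)) ?_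
    exact hfu
  · refine Finset.sum_congr rfl fun α' _ => ?_
    congr 1
    have hPu : ∀ α, fderiv ℝ (fun p => Φ.frameMatrix e he' α' α (ψ.symm p)) (ψ x)
        (mfderiv 𝓘(ℝ, EM) 𝓘(ℝ, EM) ψ x u) = tangentDeriv (Φ.frameMatrix e he' α' α) x u :=
      fun α => (hP α' α).2 u
    simp [ψ.left_inv hx, ← hPu]

end BundleMaps

/-! ### Cancellation of the derivatives of P -/

/-- The linear algebra behind the invariance of Lagrange's equations: `P` is the matrix of a
surjective bundle map, `dP α' α β` the derivative of its entry `(α', α)` in the direction `β`, and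
`C`, `C'` are the structure constants. -/
theorem lagrange_eq_of_lagrange_eq_comp {n n' : ℕ} {P : Fin n' → Fin n → ℝ}
    {dP : Fin n' → Fin n → Fin n → ℝ} {C : Fin n → Fin n → Fin n → ℝ}
    {C' : Fin n' → Fin n' → Fin n' → ℝ} {y : Fin n → ℝ} {y' p D R : Fin n' → ℝ}
    (hy : ∀ γ', y' γ' = ∑ β, y β * P γ' β)
    (hC : ∀ α' α β, ∑ γ, P α' γ * C γ α β
      = dP α' β α - dP α' α β + ∑ β', ∑ γ', P β' α * P γ' β * C' α' β' γ')
    (hL : ∀ α, ∑ α', ((∑ β, y β * dP α' α β) * p α' + P α' α * D α')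
      = (∑ α', P α' α * R α' + ∑ α', (∑ β, y β * dP α' β α) * p α')
        - ∑ γ, ∑ β, (∑ α', P α' γ * p α') * C γ α β * y β)
    {α₀ : Fin n'} {c : Fin n → ℝ} (hc : ∀ α', ∑ α, c α * P α' α = if α' = α₀ then 1 else 0) :
    D α₀ = R α₀ - ∑ γ', ∑ β', p γ' * C' γ' α₀ β' * y' β' := by
  have h1 : ∀ α, ∑ γ, ∑ β, (∑ α', P α' γ * p α') * C γ α β * y β
      = ∑ α', ∑ β, p α' * y β * ∑ γ, P α' γ * C γ α β := by
    intro α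
    simp only [Finset.sum_mul, Finset.mul_sum]
    rw [Finset.sum_congr rfl fun γ _ => Finset.sum_comm, Finset.sum_comm]
    refine Finset.sum_congr rfl fun α' _ => ?_
    rw [Finset.sum_comm]
    exact Finset.sum_congr rfl fun β _ => Finset.sum_congr rfl fun γ _ => by ring
  have h2 : ∀ α, ∑ α', ∑ β, p α' * y β * ∑ β', ∑ γ', P β' α * P γ' β * C' α' β' γ'
      = ∑ β', P β' α * ∑ α', ∑ γ', p α' * C' α' β' γ' * y' γ' := by
    intro α
    simp only [hy, Finset.mul_sum]
    conv_rhs => rw [Finset.sum_comm]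
    refine Finset.sum_congr rfl fun α' _ => ?_
    rw [Finset.sum_comm]
    refine Finset.sum_congr rfl fun β' _ => ?_
    rw [Finset.sum_comm]
    exact Finset.sum_congr rfl fun γ' _ => Finset.sum_congr rfl fun β _ => by ring
  -- Once `hC` replaces C, every term in dP cancels, and what remains is the transpose of P applied
  -- to the Lagrange expression of L'.
  have h3 : ∀ α, ∑ α', P α' α * (D α' - R α' + ∑ γ', ∑ β', p γ' * C' γ' α' β' * y' β') = 0 := by
    intro α
    have hα := hL α
    rw [h1] at hα
    simp only [hC, mul_add, mul_sub, Finset.sum_add_distrib, Finset.sum_sub_distrib] at hα ⊢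
    rw [h2] at hα
    have h4 : ∀ d : Fin n' → Fin n → ℝ,
        ∑ α', (∑ β, y β * d α' β) * p α' = ∑ α', ∑ β, p α' * y β * d α' β := fun d =>
      Finset.sum_congr rfl fun α' _ => by
        rw [Finset.sum_mul]; exact Finset.sum_congr rfl fun β _ => by ring
    rw [h4 fun α' β => dP α' α β, h4 fun α' β => dP α' β α] at hα
    linarith
  -- Contracting with c, a preimage under P of the basis vector α₀, isolates the component α₀.
  have h5 : ∑ α, c α * ∑ α', P α' α * (D α' - R α' + ∑ γ', ∑ β', p γ' * C' γ' α' β' * y' β')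
      = D α₀ - R α₀ + ∑ γ', ∑ β', p γ' * C' γ' α₀ β' * y' β' := by
    generalize hG : (fun α' => D α' - R α' + ∑ γ', ∑ β', p γ' * C' γ' α' β' * y' β') = G
    have hG' : ∀ α', D α' - R α' + ∑ γ', ∑ β', p γ' * C' γ' α' β' * y' β' = G α' :=
      congrFun hG
    simp only [hG', Finset.mul_sum, ← mul_assoc]
    rw [Finset.sum_comm]
    simp only [← Finset.sum_mul, hc]
    simp
  simp only [h3, mul_zero, Finset.sum_const_zero] at h5
  linarith

/-! ### Transport of paths and of solutions -/

section BundleMaps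

open Topology

variable {EM : Type*} [NormedAddCommGroup EM] [NormedSpace ℝ EM] [FiniteDimensional ℝ EM]
  {M : Type*} [TopologicalSpace M] [ChartedSpace EM M] [IsManifold 𝓘(ℝ, EM) ∞ M] [T2Space M]
  {F : Type*} [NormedAddCommGroup F] [NormedSpace ℝ F] [FiniteDimensional ℝ F]
  {E : M → Type*} [TopologicalSpace (TotalSpace F E)]
  [∀ x, AddCommGroup (E x)] [∀ x, Module ℝ (E x)] [∀ x, TopologicalSpace (E x)]
  [FiberBundle F E] [VectorBundle ℝ F E] [ContMDiffVectorBundle ∞ F E 𝓘(ℝ, EM)]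
  {EM' : Type*} [NormedAddCommGroup EM'] [NormedSpace ℝ EM'] [FiniteDimensional ℝ EM']
  {M' : Type*} [TopologicalSpace M'] [ChartedSpace EM' M'] [IsManifold 𝓘(ℝ, EM') ∞ M']
  [T2Space M']
  {F' : Type*} [NormedAddCommGroup F'] [NormedSpace ℝ F'] [FiniteDimensional ℝ F']
  {E' : M' → Type*} [TopologicalSpace (TotalSpace F' E')]
  [∀ x, AddCommGroup (E' x)] [∀ x, Module ℝ (E' x)] [∀ x, TopologicalSpace (E' x)]
  [FiberBundle F' E'] [VectorBundle ℝ F' E'] [ContMDiffVectorBundle ∞ F' E' 𝓘(ℝ, EM')]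
  {A : LieAlgebroid EM F E} {A' : LieAlgebroid EM' F' E'}
  {Φ : SmoothBundleMap EM F E EM' F' E'}

/-- A morphism of Lie algebroids maps `E`-paths to `E'`-paths. -/
theorem LieAlgebroid.IsPath.total_comp (hΦ : Φ.IsMorphism A A') {t₀ t₁ : ℝ}
    {a : ℝ → TotalSpace F E} (ha : A.IsPath t₀ t₁ a) : A'.IsPath t₀ t₁ (Φ.total ∘ a) where
  contMDiffOn := (Φ.smooth.of_le (by simp)).comp_contMDiffOn ha.contMDiffOn
  admissible t ht := by
    have hb : MDifferentiableAt 𝓘(ℝ, EM) 𝓘(ℝ, EM') Φ.base (a t).1 :=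
      Φ.base_smooth.contMDiffAt.mdifferentiableAt (by simp)
    refine (HasMFDerivAt.comp_hasMFDerivWithinAt t hb.hasMFDerivAt
      (ha.admissible t ht)).congr_mfderiv ?_
    refine ContinuousLinearMap.ext fun r => ?_
    refine ((mfderiv 𝓘(ℝ, EM) 𝓘(ℝ, EM') Φ.base (a t).1).map_smul r
      (A.anchor (a t).1 (a t).2)).trans ?_
    rw [hΦ.mfderiv_base_anchor]
    rfl

/-- If `Φ` is a fiberwise surjective morphism, then `Φ` maps solutions of Lagrange's equations for
`L' ∘ Φ` to solutions of Lagrange's equations for `L'`. -/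
theorem LieAlgebroid.IsLagrangeSolution.total_comp (hΦ : Φ.IsMorphism A A')
    (hsurj : ∀ x, Function.Surjective (Φ.fiber x)) {L' : TotalSpace F' E' → ℝ}
    (hL' : ContMDiff (𝓘(ℝ, EM').prod 𝓘(ℝ, F')) 𝓘(ℝ, ℝ) ∞ L') {t₀ t₁ : ℝ} (h₀₁ : t₀ < t₁)
    {a : ℝ → TotalSpace F E} (ha : A.IsLagrangeSolution (L' ∘ Φ.total) t₀ t₁ a) :
    A'.IsLagrangeSolution L' t₀ t₁ (Φ.total ∘ a) := by
  have hpath := ha.isPath.total_comp hΦ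
  refine ⟨hpath, fun ψ' hψ' n' e' U' hU' he' t ht htU' htψ' => ?_⟩
  intro x' y' C' r' Ly' α₀
  -- The target coordinates are arbitrary, but on E a single chart and frame near γ(t) are enough.
  obtain ⟨n, e, U, hU, htU, he⟩ :=
    exists_smoothSection_localFrame (EM := EM) (F := F) (E := E) (a t).1
  let ψ := chartAt EM (a t).1
  have hψ : ψ ∈ IsManifold.maximalAtlas 𝓘(ℝ, EM) ∞ M := IsManifold.chart_mem_maximalAtlas _
  have htψ : (a t).1 ∈ ψ.source := mem_chart_source EM _
  have htU'' : Φ.base (a t).1 ∈ U' := htU'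
  have htψ'' : Φ.base (a t).1 ∈ ψ'.source := htψ'
  let P := Φ.frameMatrix e he'
  let y : ℝ → Fin n → ℝ := fun s α => he.coeff α (a s).1 (a s).2
  have hy : ∀ s, (a s).1 ∈ U → ∀ γ', y' s γ' = ∑ β, y s β * P γ' β (a s).1 := by
    intro s hs γ'
    rw [← Φ.coeff_fiber_sum e he', he.sum_coeff_smul hs]
    rfl
  -- Used with u = 0 and w a basis vector for the fibre derivatives, and with u = ρ(e_α) and w = 0
  -- for the base derivatives.
  have hfd : ∀ s, (a s).1 ∈ U → (a s).1 ∈ ψ.source → Φ.base (a s).1 ∈ U' →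
      Φ.base (a s).1 ∈ ψ'.source → ∀ (u : TangentSpace 𝓘(ℝ, EM) (a s).1) (w : Fin n → ℝ),
      fderiv ℝ (localExpr (L' ∘ Φ.total) ψ e) (ψ (a s).1, y s)
          (mfderiv 𝓘(ℝ, EM) 𝓘(ℝ, EM) ψ (a s).1 u, w)
        = fderiv ℝ (localExpr L' ψ' e') (x' s, y' s)
            (mfderiv 𝓘(ℝ, EM') 𝓘(ℝ, EM') ψ' (Φ.base (a s).1)
              (mfderiv 𝓘(ℝ, EM) 𝓘(ℝ, EM') Φ.base (a s).1 u), 0)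
          + ∑ α', (∑ α, (y s α * tangentDeriv (P α' α) (a s).1 u + P α' α (a s).1 * w α))
            * Ly' α' s := by
    intro s h1 h2 h3 h4 u w
    have h := Φ.fderiv_localExpr_comp_total e hU' he' hL' hψ hψ' h2 h3 h4 (y s) w u
    rw [show (fun α' => ∑ α, y s α * Φ.frameMatrix e he' α' α (a s).1) = y' s from
      funext fun γ' => (hy s h1 γ').symm] at h
    exact h
  let Ly : Fin n → ℝ → ℝ := fun α s =>
    fderiv ℝ (localExpr (L' ∘ Φ.total) ψ e) (ψ (a s).1, y s) (0, Pi.single α 1)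
  have hLy : ∀ s, (a s).1 ∈ U → (a s).1 ∈ ψ.source → Φ.base (a s).1 ∈ U' →
      Φ.base (a s).1 ∈ ψ'.source → ∀ α, Ly α s = ∑ α', P α' α (a s).1 * Ly' α' s := by
    intro s h1 h2 h3 h4 α
    have h := hfd s h1 h2 h3 h4 0 (Pi.single α 1)
    simp only [map_zero] at h
    have h0 : fderiv ℝ (localExpr L' ψ' e') (x' s, y' s) ((0 : EM'), (0 : Fin n' → ℝ)) = 0 :=
      map_zero _
    refine h.trans ((congrArg (· + _) h0).trans ?_)
    rw [zero_add]
    refine Finset.sum_congr rfl fun α' _ => ?_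
    congr 1
    have hz : ∀ β, tangentDeriv (EM := EM) (P α' β) (a s).1 0 = 0 := fun β =>
      (mfderiv 𝓘(ℝ, EM) 𝓘(ℝ, ℝ) (P α' β) (a s).1).map_zero
    simp [hz, Pi.single_apply]
  have hcont : ContinuousWithinAt (fun s => (a s).1) (Set.Icc t₀ t₁) t :=
    (FiberBundle.continuous_proj F E).continuousAt.comp_continuousWithinAt
      (ha.isPath.contMDiffOn t ht).continuousWithinAt
  have hnear : ∀ᶠ s in 𝓝[Set.Icc t₀ t₁] t, (a s).1 ∈ U ∧ (a s).1 ∈ ψ.source ∧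
      Φ.base (a s).1 ∈ U' ∧ Φ.base (a s).1 ∈ ψ'.source := by
    have hcont' := Φ.base_smooth.continuous.continuousAt.comp_continuousWithinAt hcont
    filter_upwards [hcont (hU.mem_nhds htU), hcont (ψ.open_source.mem_nhds htψ),
      hcont' (hU'.mem_nhds htU''), hcont' (ψ'.open_source.mem_nhds htψ'')] with s h1 h2 h3 h4
    exact ⟨h1, h2, h3, h4⟩
  -- Differentiability of ∂L'/∂y' comes from a' being C¹, not from the equations for L; those only
  -- determine the value of the derivative.
  have hdiff : ∀ α', HasDerivWithinAt (Ly' α') (derivWithin (Ly' α') (Set.Icc t₀ t₁) t)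
      (Set.Icc t₀ t₁) t := fun α' =>
    (differentiableWithinAt_fderiv_localExpr hL' hψ' hU' he' (hpath.contMDiffOn t ht)
      htU' htψ' (0, Pi.single α' 1)).hasDerivWithinAt
  let dP : Fin n' → Fin n → Fin n → ℝ := fun α' α β =>
    tangentDeriv (P α' α) (a t).1 (A.anchor (a t).1 (e β (a t).1))
  have hanchor : A.anchor (a t).1 (a t).2 = ∑ β, y t β • A.anchor (a t).1 (e β (a t).1) := by
    conv_lhs => rw [← he.sum_coeff_smul htU (a t).2]
    rw [map_sum]
    simp only [map_smul]
    rfl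
  have hdP : ∀ α' α, HasDerivWithinAt (fun s => P α' α (a s).1) (∑ β, y t β * dP α' α β)
      (Set.Icc t₀ t₁) t := by
    intro α' α
    have h := ha.isPath.hasDerivWithinAt_comp ht
      (Φ.mdifferentiableAt_frameMatrix e hU' he' htU'' α' α)
    rw [hanchor] at h
    convert h using 1
    simp only [dP, P, tangentDeriv, map_sum, map_smul]
    rfl
  have hderiv : ∀ α, HasDerivWithinAt (Ly α)
      (∑ α', ((∑ β, y t β * dP α' α β) * Ly' α' t
        + P α' α (a t).1 * derivWithin (Ly' α') (Set.Icc t₀ t₁) t)) (Set.Icc t₀ t₁) t := by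
    intro α
    refine (HasDerivWithinAt.fun_sum fun α' _ => (hdP α' α).mul (hdiff α')).congr_of_eventuallyEq
      ?_ (hLy t htU htψ htU'' htψ'' α)
    filter_upwards [hnear] with s hs
    exact hLy s hs.1 hs.2.1 hs.2.2.1 hs.2.2.2 α
  have hr : ∀ α, fderiv ℝ (localExpr L' ψ' e') (x' t, y' t)
      (mfderiv 𝓘(ℝ, EM') 𝓘(ℝ, EM') ψ' (Φ.base (a t).1)
        (mfderiv 𝓘(ℝ, EM) 𝓘(ℝ, EM') Φ.base (a t).1 (A.anchor (a t).1 (e α (a t).1))), 0)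
      = ∑ α', P α' α (a t).1 * fderiv ℝ (localExpr L' ψ' e') (x' t, y' t) (r' α', 0) := by
    intro α
    have h1 : (mfderiv 𝓘(ℝ, EM') 𝓘(ℝ, EM') ψ' (Φ.base (a t).1)
        (mfderiv 𝓘(ℝ, EM) 𝓘(ℝ, EM') Φ.base (a t).1 (A.anchor (a t).1 (e α (a t).1))) : EM')
        = ∑ α', P α' α (a t).1 • r' α' := by
      rw [hΦ.mfderiv_base_anchor]
      conv_lhs => rw [← he'.sum_coeff_smul htU'' (Φ.fiber (a t).1 (e α (a t).1))]
      simp only [map_sum, map_smul]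
      rfl
    rw [h1, show ((∑ α', P α' α (a t).1 • r' α' : EM'), (0 : Fin n' → ℝ))
      = ∑ α', P α' α (a t).1 • ((r' α' : EM'), (0 : Fin n' → ℝ)) from
        Prod.ext (by simp [Prod.fst_sum]) (by simp [Prod.snd_sum])]
    simp only [map_sum, map_smul, smul_eq_mul]
  -- The only use of surjectivity: the coefficients of v are the column c required by the linear
  -- algebra.
  obtain ⟨v, hv⟩ := hsurj (a t).1 (e' α₀ (Φ.base (a t).1))
  have key := lagrange_eq_of_lagrange_eq_comp (P := fun α' α => P α' α (a t).1) (dP := dP)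
    (C := fun γ α β => he.coeff γ (a t).1 (A.bracket (e α) (e β) (a t).1)) (C' := C')
    (y := y t) (y' := y' t) (p := fun α' => Ly' α' t)
    (D := fun α' => derivWithin (Ly' α') (Set.Icc t₀ t₁) t)
    (R := fun α' => fderiv ℝ (localExpr L' ψ' e') (x' t, y' t) (r' α', 0))
    (α₀ := α₀) (c := fun α => he.coeff α (a t).1 v) (hy t htU) ?_ ?_ ?_
  · have h := hdiff α₀
    rw [key] at h
    exact h
  · intro α' α β
    have h := hΦ.coeff_bracket hU' he' htU'' (e α) (e β) α'
    rw [← he.sum_coeff_smul htU (A.bracket (e α) (e β) (a t).1), Φ.coeff_fiber_sum e he'] at h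
    refine Eq.trans ?_ h
    exact Finset.sum_congr rfl fun γ _ => mul_comm _ _
  · intro α
    -- The product rule and the equations for L give two derivatives of the same function. They
    -- agree, also at the endpoints, because t₀ < t₁ makes derivatives within the interval unique.
    have h := (uniqueDiffOn_Icc h₀₁ t ht).eq_deriv _ (hderiv α)
      (ha.lagrange ψ hψ n e U hU he t ht htU htψ α)
    refine h.trans ?_
    congr 1
    · refine (hfd t htU htψ htU'' htψ'' (A.anchor (a t).1 (e α (a t).1)) 0).trans ?_
      rw [hr]
      simp [dP]
    · refine Finset.sum_congr rfl fun γ _ => Finset.sum_congr rfl fun β _ => ?_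
      rw [← hLy t htU htψ htU'' htψ'' γ]
  · intro α'
    change ∑ α, he.coeff α (a t).1 v * Φ.frameMatrix e he' α' α (a t).1 = _
    rw [← Φ.coeff_fiber_sum e he', he.sum_coeff_smul htU, hv]
    have h := he'.coeff_self htU'' α' α₀
    rw [h]
    simp only [eq_comm]

end BundleMaps

theorem mainTheorem2
    {EM : Type*} [NormedAddCommGroup EM] [NormedSpace ℝ EM] [FiniteDimensional ℝ EM]
    {M : Type*} [TopologicalSpace M] [ChartedSpace EM M] [IsManifold 𝓘(ℝ, EM) ∞ M]
    [T2Space M] [SigmaCompactSpace M]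
    {F : Type*} [NormedAddCommGroup F] [NormedSpace ℝ F] [FiniteDimensional ℝ F]
    {E : M → Type*} [TopologicalSpace (TotalSpace F E)]
    [∀ x, AddCommGroup (E x)] [∀ x, Module ℝ (E x)] [∀ x, TopologicalSpace (E x)]
    [FiberBundle F E] [VectorBundle ℝ F E] [ContMDiffVectorBundle ∞ F E 𝓘(ℝ, EM)]
    {EM' : Type*} [NormedAddCommGroup EM'] [NormedSpace ℝ EM'] [FiniteDimensional ℝ EM']
    {M' : Type*} [TopologicalSpace M'] [ChartedSpace EM' M'] [IsManifold 𝓘(ℝ, EM') ∞ M']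
    [T2Space M'] [SigmaCompactSpace M']
    {F' : Type*} [NormedAddCommGroup F'] [NormedSpace ℝ F'] [FiniteDimensional ℝ F']
    {E' : M' → Type*} [TopologicalSpace (TotalSpace F' E')]
    [∀ x, AddCommGroup (E' x)] [∀ x, Module ℝ (E' x)] [∀ x, TopologicalSpace (E' x)]
    [FiberBundle F' E'] [VectorBundle ℝ F' E'] [ContMDiffVectorBundle ∞ F' E' 𝓘(ℝ, EM')]
    (A : LieAlgebroid EM F E) (A' : LieAlgebroid EM' F' E')
    (Φ : SmoothBundleMap EM F E EM' F' E') (hΦ : Φ.IsMorphism A A')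
    (hsurj : ∀ x, Function.Surjective (Φ.fiber x))
    (L : TotalSpace F E → ℝ) (L' : TotalSpace F' E' → ℝ)
    (hL : ContMDiff (𝓘(ℝ, EM).prod 𝓘(ℝ, F)) 𝓘(ℝ, ℝ) ∞ L)
    (hL' : ContMDiff (𝓘(ℝ, EM').prod 𝓘(ℝ, F')) 𝓘(ℝ, ℝ) ∞ L')
    (hLL' : L = L' ∘ Φ.total)
    (t₀ t₁ : ℝ) (ht : t₀ < t₁) (a : ℝ → TotalSpace F E)
    (ha : A.IsLagrangeSolution L t₀ t₁ a) :
    A'.IsLagrangeSolution L' t₀ t₁ (Φ.total ∘ a) := by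
  subst hLL'
  exact ha.total_comp hΦ hsurj hL' ht
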